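/- For $n\ge 0$ let $S^n=\{u\in\mathbb{R}^{n+1}:\|u\|=1\}$. Call a function $k:\mathcal U\times\mathcal U\to\mathbb{R}$ on a nonempty set $\mathcal U$ a positive definite kernel if $k(u,v)=k(v,u)$ for all $u,v\in\mathcal U$ and $\sum_{j=1}^{N}\sum_{i=1}^{N}c_ic_jk(u_i,u_j)\ge 0$ for all $N\in\mathbb{N}$, $u_1,\dots,u_N\in\mathcal U$ and $c_1,\dots,c_N\in\mathbb{R}$. Let $k$ be a radial kernel given on all the spheres $S^n$ simultaneously, that is, there is a real function $f$, the same for all $n$, such that $k(u,v)=f(\|u-v\|)$ for every $n$ and all $u,v\in S^n$. (No continuity is assumed.) Then $k$ is positive definite on $S^n$ for every $n$ if and only if there is a unique family of real coefficients $(\alpha_m)_{m\ge -2}$ such that every $\alpha_m\ge 0$, $\sum_{m=-2}^{\infty}\alpha_m<\infty$, and, for every $n$ and all $u,v\in S^n$, $$k(u,v)=\sum_{m=0}^{\infty}\alpha_m\langle u,v\rangle^m+\alpha_{-1}\bigl(\llbracket\langle u,v\rangle=1\rrbracket-\llbracket\langle u,v\rangle=-1\rrbracket\bigr)+\alpha_{-2}\,\llbracket\langle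 u,v\rangle\in\{-1,1\}\rrbracket ,$$ where $\llbracket P\rrbracket$ is $1$ if $P$ holds and $0$ otherwise, and $\langle u,v\rangle^0=1$. -/

import Mathlib

/-- A real kernel `k` on `U` is positive definite if it is symmetric and all its quadratic forms
over finitely many points are nonnegative. -/
structure IsPosDefKernel {U : Type*} (k : U → U → ℝ) : Prop where
  symm : ∀ u v, k u v = k v u
  nonneg : ∀ (N : ℕ) (u : Fin N → U) (c : Fin N → ℝ),
    0 ≤ ∑ j, ∑ i, c i * c j * k (u i) (u j)

/-- The unit sphere `S^n` of the Euclidean space `ℝ^(n+1)`. -/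
abbrev UnitSphere (n : ℕ) : Type :=
  Metric.sphere (0 : EuclideanSpace ℝ (Fin (n + 1))) 1

/-- A kernel given on all the spheres `S^n` is radial if its value at `(u, v)` is one and the same
function (not depending on `n`) of the distance of `u` and `v`. -/
def IsRadialKernel (k : ∀ n : ℕ, UnitSphere n → UnitSphere n → ℝ) : Prop :=
  ∃ f : ℝ → ℝ, ∀ (n : ℕ) (u v : UnitSphere n), k n u v = f (dist u v)

open Classical in
/-- The Iverson bracket. -/
noncomputable def iverson (P : Prop) : ℝ := if P then 1 else 0

/-- The coefficients `α_m` for `m ≥ 0` (`power m`), `α_{-1}` (`odd`) and `α_{-2}` (`even`). -/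
@[ext]
structure SeriesCoeffs where
  power : ℕ → ℝ
  odd : ℝ
  even : ℝ

/-- `α` has nonnegative summable coefficients, and on every sphere `S^n` the kernel `k` is
the series with coefficients `α`. -/
structure IsSeriesRepresentation (k : ∀ n : ℕ, UnitSphere n → UnitSphere n → ℝ)
    (α : SeriesCoeffs) : Prop where
  power_nonneg : ∀ m, 0 ≤ α.power m
  odd_nonneg : 0 ≤ α.odd
  even_nonneg : 0 ≤ α.even
  summable : Summable α.power
  eq : ∀ (n : ℕ) (u v : UnitSphere n),
    k n u v = ∑' m : ℕ, α.power m * (inner ℝ u.1 v.1 : ℝ) ^ m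
      + α.odd * (iverson ((inner ℝ u.1 v.1 : ℝ) = 1) - iverson ((inner ℝ u.1 v.1 : ℝ) = -1))
      + α.even * iverson ((inner ℝ u.1 v.1 : ℝ) ∈ ({-1, 1} : Set ℝ))

/-!
A radial kernel is a function `g` of the inner product, so the claim is about the functions `g` on
`[-1, 1]` for which all matrices `g ⟪u i, u j⟫` of unit vectors are positive semidefinite
(`OperatesOnGram`).

Every series in the theorem gives such a function: powers of the inner product are positive definite
by the Schur product theorem, and the two discontinuous terms are the pointwise limits of the odd
and of the even powers (`IsSeriesRepresentation.isPosDefKernel`).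

Conversely, inscribe a cube `{1, -1} ^ d` in the sphere. The function `ε ↦ g (mean ε)` on the cube is
positive definite and invariant under permutations of the coordinates, so it is a nonnegative
combination of the elementary symmetric functions of the signs. At a point with `k` negative signs,
that is at `t = (d - 2 * k) / d`, these are the normalized Krawtchouk polynomials
(`OperatesOnGram.exists_krawtchouk_expansion`). As `d → ∞` with `t` fixed, the one of degree `m` tends
to `t ^ m` (`tendsto_krawtchouk`). Degrees `m` and `d - m` agree for even `k`, and all degrees from
`M` to `d - M` are uniformly bounded by a quantity that tends to `|t| ^ M` (`krawtchouk_sq_le`).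
A limit of the coefficients along an ultrafilter therefore represents `g` by a power series at all
rational points of `(-1, 1)` (`OperatesOnGram.exists_powerSeries_rat`).

No continuity is assumed. To reach irrational points, the positivity of `g` is extended to Gram
matrices of vectors in the ball, by adding mutually orthogonal components and averaging
(`OperatesOnGram.sum_nonneg_of_norm_le_one`). This makes `g` monotone on `[0, 1]`, hence equal to
the power series on `[0, 1)`; a three-point inequality then transfers continuity from there to all
of `(-1, 1)` (`OperatesOnGram.exists_powerSeries`). Four vectors `±u`, `±v` show that the odd and the
even part of `g` have nonnegative jumps at `1` (`OperatesOnGram.endpoint_le`); these are the two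
remaining coefficients. Uniqueness is that of power series, followed by evaluation at `±1`.
-/

open Filter Topology

/-! ### Kernels given by series are positive definite -/

/-- Powers of the inner product are positive definite kernels, by the Schur product theorem. -/
theorem sum_mul_inner_pow_nonneg {E : Type*} [NormedAddCommGroup E] [InnerProductSpace ℝ E]
    {ι : Type*} [Fintype ι] (u : ι → E) (c : ι → ℝ) (m : ℕ) :
    0 ≤ ∑ j, ∑ i, c i * c j * (inner ℝ (u i) (u j) : ℝ) ^ m := by
  classical
  have h : (Matrix.of fun i j => (inner ℝ (u i) (u j) : ℝ) ^ m).PosSemidef := by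
    induction m with
    | zero =>
      have : (Matrix.of fun i j => (inner ℝ (u i) (u j) : ℝ) ^ 0) =
          Matrix.gram ℝ (fun _ : ι => (1 : ℝ)) := by
        ext i j
        simp [Matrix.gram_apply]
      rw [this]
      exact Matrix.posSemidef_gram ℝ _
    | succ m ih =>
      have : (Matrix.of fun i j => (inner ℝ (u i) (u j) : ℝ) ^ (m + 1)) =
          Matrix.hadamard (Matrix.of fun i j => (inner ℝ (u i) (u j) : ℝ) ^ m)
            (Matrix.gram ℝ u) := by
        ext i j
        simp [Matrix.gram_apply, pow_succ]
      rw [this]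
      exact ih.hadamard (Matrix.posSemidef_gram ℝ u)
  refine (h.dotProduct_mulVec_nonneg c).trans_eq ?_
  simp only [dotProduct, Matrix.mulVec, Matrix.of_apply, Finset.mul_sum, Pi.star_apply,
    star_trivial]
  rw [Finset.sum_comm]
  refine Finset.sum_congr rfl fun j _ => Finset.sum_congr rfl fun i _ => by ring

theorem tendsto_pow_two_mul_iverson {t : ℝ} (ht : |t| ≤ 1) :
    Tendsto (fun M : ℕ => t ^ (2 * M)) atTop (𝓝 (iverson (t ∈ ({-1, 1} : Set ℝ)))) := by
  unfold iverson
  split_ifs with h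
  · rcases h with h | h <;> rw [h] <;> simp
  · simp only [pow_mul]
    refine tendsto_pow_atTop_nhds_zero_of_lt_one (sq_nonneg t) ?_
    rw [sq_lt_one_iff_abs_lt_one]
    refine lt_of_le_of_ne ht fun h1 => h ?_
    rcases eq_or_eq_neg_of_abs_eq h1 with h1 | h1 <;> simp [h1]

theorem tendsto_pow_two_mul_add_one_iverson {t : ℝ} (ht : |t| ≤ 1) :
    Tendsto (fun M : ℕ => t ^ (2 * M + 1)) atTop
      (𝓝 (iverson (t = 1) - iverson (t = -1))) := by
  have h := (tendsto_pow_two_mul_iverson ht).mul_const t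
  simp only [← pow_succ] at h
  convert h using 2
  unfold iverson
  by_cases h1 : t = 1
  · subst h1; norm_num
  by_cases h2 : t = -1
  · subst h2; norm_num
  · simp [h1, h2]

theorem abs_inner_sphere_le_one {n : ℕ} (u v : UnitSphere n) :
    |(inner ℝ u.1 v.1 : ℝ)| ≤ 1 := by
  simpa using abs_real_inner_le_norm u.1 v.1

theorem summable_mul_pow_of_abs_le_one {a : ℕ → ℝ} (ha : ∀ m, 0 ≤ a m) (hs : Summable a)
    {t : ℝ} (ht : |t| ≤ 1) : Summable fun m => a m * t ^ m := by
  refine Summable.of_norm_bounded hs fun m => ?_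
  rw [Real.norm_eq_abs, abs_mul, abs_pow, abs_of_nonneg (ha m)]
  exact mul_le_of_le_one_right (ha m) (pow_le_one₀ (abs_nonneg t) ht)

/-- A series kernel is the pointwise limit of nonnegative combinations of powers of the inner
product: the two discontinuous terms are the limits of the odd and of the even powers. -/
theorem IsSeriesRepresentation.isPosDefKernel
    {k : ∀ n : ℕ, UnitSphere n → UnitSphere n → ℝ} {α : SeriesCoeffs}
    (h : IsSeriesRepresentation k α) (n : ℕ) : IsPosDefKernel (k n) := by
  refine ⟨fun u v => by rw [h.eq, h.eq, real_inner_comm], fun N u c => ?_⟩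
  have key : ∀ i j, Tendsto (fun M : ℕ =>
      ∑ m ∈ Finset.range M, α.power m * (inner ℝ (u i).1 (u j).1 : ℝ) ^ m
      + α.odd * (inner ℝ (u i).1 (u j).1 : ℝ) ^ (2 * M + 1)
      + α.even * (inner ℝ (u i).1 (u j).1 : ℝ) ^ (2 * M)) atTop (𝓝 (k n (u i) (u j))) := by
    intro i j
    have ht := abs_inner_sphere_le_one (u i) (u j)
    rw [h.eq]
    exact ((summable_mul_pow_of_abs_le_one h.power_nonneg h.summable ht).hasSum.tendsto_sum_nat.add
      ((tendsto_pow_two_mul_add_one_iverson ht).const_mul _)).add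
      ((tendsto_pow_two_mul_iverson ht).const_mul _)
  refine ge_of_tendsto' (tendsto_finsetSum _ fun j _ => tendsto_finsetSum _ fun i _ =>
    (key i j).const_mul (c i * c j)) fun M => ?_
  have Q := fun m => sum_mul_inner_pow_nonneg (fun i => (u i).1) c m
  have : 0 ≤ ∑ m ∈ Finset.range M, α.power m *
        (∑ j, ∑ i, c i * c j * (inner ℝ (u i).1 (u j).1 : ℝ) ^ m)
      + α.odd * (∑ j, ∑ i, c i * c j * (inner ℝ (u i).1 (u j).1 : ℝ) ^ (2 * M + 1))
      + α.even * (∑ j, ∑ i, c i * c j * (inner ℝ (u i).1 (u j).1 : ℝ) ^ (2 * M)) :=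
    add_nonneg (add_nonneg (Finset.sum_nonneg fun m _ => mul_nonneg (h.power_nonneg m) (Q m))
      (mul_nonneg h.odd_nonneg (Q _))) (mul_nonneg h.even_nonneg (Q _))
  refine this.trans_eq ?_
  simp only [mul_add, Finset.sum_add_distrib, Finset.mul_sum]
  congr 1
  · congr 1
    · rw [Finset.sum_comm]
      refine Finset.sum_congr rfl fun j _ => ?_
      rw [Finset.sum_comm]
      exact Finset.sum_congr rfl fun i _ => Finset.sum_congr rfl fun m _ => by ring
    · exact Finset.sum_congr rfl fun j _ => Finset.sum_congr rfl fun i _ => by ring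
  · exact Finset.sum_congr rfl fun j _ => Finset.sum_congr rfl fun i _ => by ring

/-! ### Functions of the inner product -/

/-- `g` operates on Gram matrices: for unit vectors `u i` of a finite-dimensional real inner
product space the matrix `g ⟪u i, u j⟫` has a nonnegative quadratic form. -/
def OperatesOnGram (g : ℝ → ℝ) : Prop :=
  ∀ (E : Type) [NormedAddCommGroup E] [InnerProductSpace ℝ E] [FiniteDimensional ℝ E]
    (ι : Type) [Fintype ι] (u : ι → E) (c : ι → ℝ), (∀ i, ‖u i‖ = 1) →
    0 ≤ ∑ i, ∑ j, c i * c j * g (inner ℝ (u i) (u j))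

theorem IsPosDefKernel.sum_nonneg {U ι : Type*} [Fintype ι] {k : U → U → ℝ}
    (hk : IsPosDefKernel k) (u : ι → U) (c : ι → ℝ) :
    0 ≤ ∑ i, ∑ j, c i * c j * k (u i) (u j) := by
  let e := Fintype.equivFin ι
  have h := hk.nonneg (Fintype.card ι) (u ∘ e.symm) (c ∘ e.symm)
  rw [Finset.sum_comm] at h
  refine h.trans_eq ?_
  rw [← e.symm.sum_comp]
  refine Finset.sum_congr rfl fun i _ => ?_
  rw [← e.symm.sum_comp]
  rfl

theorem operatesOnGram_of_isPosDefKernel {k : ∀ n : ℕ, UnitSphere n → UnitSphere n → ℝ}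
    {g : ℝ → ℝ} (hg : ∀ (n : ℕ) (u v : UnitSphere n), k n u v = g (inner ℝ u.1 v.1))
    (hk : ∀ n, IsPosDefKernel (k n)) : OperatesOnGram g := by
  intro E _ _ _ ι _ u c hu
  rcases isEmpty_or_nonempty ι with hι | ⟨⟨i₀⟩⟩
  · simp
  obtain ⟨n, hn⟩ : ∃ n, Module.finrank ℝ E = n + 1 := by
    refine Nat.exists_eq_succ_of_ne_zero fun h0 => ?_
    have := Module.finrank_zero_iff.1 h0
    have h1 := hu i₀
    rw [Subsingleton.elim (u i₀) 0, norm_zero] at h1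
    exact zero_ne_one h1
  let b := ((stdOrthonormalBasis ℝ E).reindex (finCongr hn)).repr
  have h := (hk n).sum_nonneg (fun i => (⟨b (u i), by simp [hu i]⟩ : UnitSphere n)) c
  simpa only [hg, LinearIsometryEquiv.inner_map_map] using h

theorem inner_pair (p q r s : ℝ) : (inner ℝ !₂[p, q] !₂[r, s] : ℝ) = p * r + q * s := by
  simp [PiLp.inner_apply, mul_comm]

theorem norm_pair_eq_one {p q : ℝ} (h : p * p + q * q = 1) : ‖!₂[p, q]‖ = 1 := by
  rw [← pow_eq_one_iff_of_nonneg (norm_nonneg _) two_ne_zero, ← real_inner_self_eq_norm_sq,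
    inner_pair]
  exact h

namespace OperatesOnGram

variable {g : ℝ → ℝ}

/-- The condition extends from the sphere to the closed ball: complete each vector `x i` by
components orthogonal to everything, in `M` different directions, and average over the
directions. As `M → ∞` the contribution of equal directions is negligible. -/
theorem sum_nonneg_of_norm_le_one (hg : OperatesOnGram g) {E : Type} [NormedAddCommGroup E]
    [InnerProductSpace ℝ E] [FiniteDimensional ℝ E] {ι : Type} [Fintype ι] (x : ι → E) (c : ι → ℝ)
    (hx : ∀ i, ‖x i‖ ≤ 1) : 0 ≤ ∑ i, ∑ j, c i * c j * g (inner ℝ (x i) (x j)) := by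
  classical
  set Q := ∑ i, ∑ j, c i * c j * g (inner ℝ (x i) (x j)) with hQ
  let r : ι → ℝ := fun i => √(1 - ‖x i‖ ^ 2)
  set D := ∑ i, ∑ j, c i * c j * g (inner ℝ (x i) (x j) + r i * r j) with hD
  have key : ∀ M : ℕ, 0 ≤ (M : ℝ) * (D + (M - 1) * Q) := by
    intro M
    let u : ι × Fin M → WithLp 2 (E × EuclideanSpace ℝ (Fin M)) := fun p =>
      WithLp.toLp 2 (x p.1, r p.1 • EuclideanSpace.single p.2 (1 : ℝ))
    have hin : ∀ p q, inner ℝ (u p) (u q) =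
        (inner ℝ (x p.1) (x q.1) : ℝ) + if p.2 = q.2 then r p.1 * r q.1 else 0 := by
      intro p q
      simp only [u, WithLp.prod_inner_apply, inner_smul_left, inner_smul_right]
      simp [EuclideanSpace.inner_single_left, mul_comm]
    have hu : ∀ p, ‖u p‖ = 1 := by
      intro p
      have h1 : ‖u p‖ ^ 2 = 1 := by
        rw [← real_inner_self_eq_norm_sq, hin, if_pos rfl, real_inner_self_eq_norm_sq,
          Real.mul_self_sqrt]
        · ring
        · nlinarith [hx p.1, norm_nonneg (x p.1)]
      exact (pow_eq_one_iff_of_nonneg (norm_nonneg _) two_ne_zero).1 h1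
    have h := hg _ _ u (fun p => c p.1) hu
    refine h.trans_eq ?_
    have hsplit : ∀ (i j : ι) (a : Fin M), ∑ b, c i * c j * g (inner ℝ (u (i, a)) (u (j, b))) =
        c i * c j * g (inner ℝ (x i) (x j) + r i * r j)
          + (M - 1) * (c i * c j * g (inner ℝ (x i) (x j))) := by
      intro i j a
      rw [← Finset.add_sum_erase _ _ (Finset.mem_univ a)]
      congr 1
      · simp [hin]
      · rw [Finset.sum_congr rfl (g := fun _ => c i * c j * g (inner ℝ (x i) (x j)))]
        · rw [Finset.sum_const, Finset.card_erase_of_mem (Finset.mem_univ a), Finset.card_univ,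
            Fintype.card_fin, nsmul_eq_mul, Nat.cast_pred a.pos]
        · intro b hb
          have : ¬ a = b := fun h => (Finset.ne_of_mem_erase hb) h.symm
          simp [hin, this]
    rw [Fintype.sum_prod_type]
    simp only [Fintype.sum_prod_type, hsplit]
    simp only [Finset.sum_add_distrib, Finset.sum_const, Finset.card_univ, Fintype.card_fin,
      nsmul_eq_mul, ← Finset.mul_sum, ← hQ, ← hD]
    ring
  by_contra hneg
  push Not at hneg
  obtain ⟨M, hM⟩ := exists_nat_gt (D / (-Q) + 1)
  have h1 : D < (M - 1) * (-Q) := by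
    rw [← div_lt_iff₀ (by linarith)]
    linarith
  have h2 : (0 : ℝ) < M ∨ M = 0 := by
    rcases Nat.eq_zero_or_pos M with h | h
    · exact Or.inr h
    · exact Or.inl (by exact_mod_cast h)
  rcases h2 with h2 | h2
  · nlinarith [key M]
  · subst h2
    have h3 := key 1
    norm_num at h3 h1
    linarith

/-- The quadratic form of two vectors of squared length `a` and inner product `b`, with weights
`1` and `-1`. -/
theorem apply_le_of_abs_le (hg : OperatesOnGram g) {a b : ℝ} (hab : |b| ≤ a) (ha : a ≤ 1) :
    g b ≤ g a := by
  obtain ⟨h1, h2⟩ := abs_le.1 hab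
  have hp := Real.mul_self_sqrt (show 0 ≤ (a + b) / 2 by linarith)
  have hm := Real.mul_self_sqrt (show 0 ≤ (a - b) / 2 by linarith)
  have hn : ∀ p q : ℝ, p * p + q * q ≤ 1 → ‖!₂[p, q]‖ ≤ 1 := by
    intro p q h
    rw [← sq_le_one_iff₀ (norm_nonneg _), ← real_inner_self_eq_norm_sq, inner_pair]
    exact h
  have h := hg.sum_nonneg_of_norm_le_one
    ![!₂[√((a + b) / 2), √((a - b) / 2)], !₂[√((a + b) / 2), -√((a - b) / 2)]] ![1, -1]
    (by
      intro i
      fin_cases i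
      · exact hn _ _ (by rw [hp, hm]; linarith)
      · exact hn _ _ (by rw [neg_mul_neg, hp, hm]; linarith))
  simp only [Fin.sum_univ_two, Matrix.cons_val_zero, Matrix.cons_val_one, inner_pair, mul_neg, neg_mul,
    hp, hm, neg_neg] at h
  have e1 : (a + b) / 2 + (a - b) / 2 = a := by ring
  have e2 : (a + b) / 2 + -((a - b) / 2) = b := by ring
  rw [e1, e2] at h
  linarith

/-- The four unit vectors `u, -u, v, -v` with weights `1, s, -1, -s` compare the values at `±1`
with those at `±⟪u, v⟫`. -/
theorem endpoint_le (hg : OperatesOnGram g) {s : ℝ} (hs : s = 1 ∨ s = -1) {ρ : ℝ}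
    (hρ : |ρ| ≤ 1) : g ρ + s * g (-ρ) ≤ g 1 + s * g (-1) := by
  have hp := Real.mul_self_sqrt (show 0 ≤ 1 - ρ ^ 2 by
    rw [sub_nonneg, sq_le_one_iff_abs_le_one]; exact hρ)
  set r := √(1 - ρ ^ 2)
  have h := hg _ _ ![!₂[1, 0], !₂[-1, 0], !₂[ρ, r], !₂[-ρ, -r]] ![1, s, -1, -s]
    (by
      intro i
      fin_cases i
      · exact norm_pair_eq_one (by ring)
      · exact norm_pair_eq_one (by ring)
      · exact norm_pair_eq_one (by rw [hp]; ring)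
      · exact norm_pair_eq_one (by rw [neg_mul_neg, neg_mul_neg, hp]; ring))
  have e1 : ρ * ρ + r * r = 1 := by rw [hp]; ring
  have e2 : -(ρ * ρ) + -(r * r) = -1 := by rw [hp]; ring
  simp [Fin.sum_univ_four, inner_pair, e1, e2, 
    -inner_self_eq_norm_sq_to_K] at h
  rcases hs with rfl | rfl <;> linarith

end OperatesOnGram

/-! ### Normalized Krawtchouk polynomials -/

section Krawtchouk
open Polynomial

/-- The generating polynomial `(1 + X) ^ (d - k) * (1 - X) ^ k` of the Krawtchouk polynomials. Its
`m`-th coefficient is the `m`-th elementary symmetric function of `d` signs, `k` of them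
negative. -/
noncomputable def krawtchoukGen (d k : ℕ) : ℝ[X] := (1 + X) ^ (d - k) * (1 - X) ^ k

/-- The mean of the products of the `m`-element subsets of `d` signs, `k` of them negative. For
`m > d` the value is `0` (by the convention on division by zero). -/
noncomputable def krawtchouk (d k m : ℕ) : ℝ := (krawtchoukGen d k).coeff m / d.choose m

theorem natDegree_krawtchoukGen_le {d k : ℕ} (hk : k ≤ d) : (krawtchoukGen d k).natDegree ≤ d := by
  refine natDegree_mul_le.trans ?_
  have h1 : ((1 + X : ℝ[X]) ^ (d - k)).natDegree ≤ (d - k) * 1 :=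
    natDegree_pow_le_of_le _ (by compute_degree)
  have h2 : ((1 - X : ℝ[X]) ^ k).natDegree ≤ k * 1 :=
    natDegree_pow_le_of_le _ (by compute_degree)
  omega

theorem krawtchoukGen_coeff {d k : ℕ} (hk : k ≤ d) (m : ℕ) :
    (krawtchoukGen d k).coeff m = d.choose m * krawtchouk d k m := by
  unfold krawtchouk
  by_cases h : d.choose m = 0
  · rw [h, Nat.cast_zero, zero_mul]
    exact coeff_eq_zero_of_natDegree_lt
      ((natDegree_krawtchoukGen_le hk).trans_lt (Nat.choose_eq_zero_iff.1 h))
  · have : (d.choose m : ℝ) ≠ 0 := by exact_mod_cast h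
    field_simp

/-- The differential equation of the generating polynomial, which encodes the three-term
recurrence of its coefficients. -/
theorem krawtchoukGen_derivative {d k : ℕ} (hk : k ≤ d) :
    (1 - X ^ 2) * derivative (krawtchoukGen d k) =
      (C ((d : ℝ) - 2 * k) - C (d : ℝ) * X) * krawtchoukGen d k := by
  have h1 : ∀ a : ℕ, (1 + X) * derivative ((1 + X : ℝ[X]) ^ a) = C (a : ℝ) * (1 + X) ^ a := by
    rintro (_ | a)
    · simp
    · rw [derivative_pow_succ]
      simp
      ring
  have h2 : ∀ a : ℕ, (1 - X) * derivative ((1 - X : ℝ[X]) ^ a) = - C (a : ℝ) * (1 - X) ^ a := by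
    rintro (_ | a)
    · simp
    · rw [derivative_pow_succ]
      simp
      ring
  obtain ⟨a, rfl⟩ := Nat.exists_eq_add_of_le hk
  unfold krawtchoukGen
  rw [Nat.add_sub_cancel_left, derivative_mul]
  have e : (C (((k + a : ℕ) : ℝ) - 2 * k) : ℝ[X]) = C (a : ℝ) - C (k : ℝ) := by
    rw [← C_sub]
    congr 1
    push_cast
    ring
  have e' : (C (((k + a : ℕ) : ℝ)) : ℝ[X]) = C (a : ℝ) + C (k : ℝ) := by
    rw [← C_add]
    push_cast
    ring_nf
  rw [e, e']
  linear_combination (1 - X) * (1 - X) ^ k * h1 a + (1 + X) * (1 + X) ^ a * h2 k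

theorem krawtchouk_zero (d k : ℕ) : krawtchouk d k 0 = 1 := by
  simp [krawtchouk, krawtchoukGen, coeff_zero_eq_eval_zero]

theorem krawtchouk_zero_right {d m : ℕ} (hm : m ≤ d) : krawtchouk d 0 m = 1 := by
  have : (d.choose m : ℝ) ≠ 0 := by exact_mod_cast (Nat.choose_pos hm).ne'
  simp [krawtchouk, krawtchoukGen, coeff_one_add_X_pow, this]

theorem krawtchouk_one {d k : ℕ} (hk : k ≤ d) : d * krawtchouk d k 1 = d - 2 * k := by
  have h := congrArg (fun p => coeff p 0) (krawtchoukGen_derivative hk)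
  simp only [mul_coeff_zero, coeff_derivative, krawtchoukGen_coeff hk, krawtchouk_zero] at h
  simpa using h

theorem krawtchouk_add_two {d k m : ℕ} (hk : k ≤ d) (hm : m + 1 ≤ d) :
    ((d : ℝ) - (m + 1)) * krawtchouk d k (m + 2) + (m + 1) * krawtchouk d k m =
      (d - 2 * k) * krawtchouk d k (m + 1) := by
  have h := congrArg (fun p => coeff p (m + 1)) (krawtchoukGen_derivative hk)
  have e1 : (d.choose (m + 2) : ℝ) * (m + 2) = d.choose (m + 1) * (d - (m + 1)) := by
    have := Nat.choose_succ_right_eq d (m + 1)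
    have h2 : ((d - (m + 1) : ℕ) : ℝ) = d - (m + 1) := by
      rw [Nat.cast_sub hm]; push_cast; ring
    rw [← h2]
    exact_mod_cast this
  have e2 : (d.choose (m + 1) : ℝ) * (m + 1) = d.choose m * (d - m) := by
    have := Nat.choose_succ_right_eq d m
    rw [← Nat.cast_sub (by omega : m ≤ d)]
    exact_mod_cast this
  have h0 : (d.choose (m + 1) : ℝ) ≠ 0 := by exact_mod_cast (Nat.choose_pos hm).ne'
  have hl : (((1 - X ^ 2) * derivative (krawtchoukGen d k)).coeff (m + 1) : ℝ) =
      (derivative (krawtchoukGen d k)).coeff (m + 1) - m * (krawtchoukGen d k).coeff m := by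
    rw [sub_mul, one_mul, coeff_sub, pow_two, mul_assoc, coeff_X_mul]
    congr 1
    cases m with
    | zero => simp
    | succ m =>
      rw [coeff_X_mul, coeff_derivative]
      push_cast
      ring
  have hr : (((C ((d : ℝ) - 2 * k) - C (d : ℝ) * X) * krawtchoukGen d k).coeff (m + 1) : ℝ) =
      (d - 2 * k) * (krawtchoukGen d k).coeff (m + 1) - d * (krawtchoukGen d k).coeff m := by
    rw [sub_mul, coeff_sub, mul_assoc, coeff_C_mul, coeff_C_mul, coeff_X_mul]
  simp only [hl, hr, coeff_derivative, krawtchoukGen_coeff hk] at h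
  push_cast at h
  refine mul_left_cancel₀ h0 ?_
  linear_combination h - krawtchouk d k (m + 2) * e1 + krawtchouk d k m * e2

theorem reflect_pow_of_natDegree_le_one {p : ℝ[X]} (hp : p.natDegree ≤ 1) (n : ℕ) :
    (p ^ n).reflect n = (p.reflect 1) ^ n := by
  induction n with
  | zero => simp
  | succ n ih =>
    rw [pow_succ, reflect_mul _ _ ((natDegree_pow_le_of_le n hp).trans (by omega)) hp, ih, pow_succ]

/-- Complementing the subsets changes the products by the product of all signs, which is `1` for
even `k`. -/
theorem krawtchouk_sub {d k m : ℕ} (hk : k ≤ d) (hke : Even k) (hm : m ≤ d) :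
    krawtchouk d k (d - m) = krawtchouk d k m := by
  have h1 : (1 + X : ℝ[X]).reflect 1 = 1 + X := by
    rw [reflect_add, reflect_one_X, reflect_one, pow_one, add_comm]
  have h2 : (1 - X : ℝ[X]).reflect 1 = -(1 - X) := by
    rw [reflect_sub, reflect_one_X, reflect_one, pow_one, neg_sub]
  have h : (krawtchoukGen d k).reflect d = krawtchoukGen d k := by
    unfold krawtchoukGen
    conv_lhs => rw [show d = (d - k) + k by omega, Nat.add_sub_cancel]
    rw [reflect_mul, reflect_pow_of_natDegree_le_one, reflect_pow_of_natDegree_le_one, h1, h2,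
      hke.neg_pow]
    · compute_degree
    · compute_degree
    · exact (natDegree_pow_le_of_le _ (m := 1) (by compute_degree)).trans (by omega)
    · exact (natDegree_pow_le_of_le _ (m := 1) (by compute_degree)).trans (by omega)
  unfold krawtchouk
  rw [Nat.choose_symm hm, ← revAt_le hm, ← coeff_reflect, h]

end Krawtchouk

/-- A bound that is uniform in the degree `m`. For `t = (d - 2 * k) / d` the quadratic form
`x ^ 2 + y ^ 2 - 2 * t * x * y` of consecutive values `x`, `y` does not increase with the degree up
to `d / 2`, and it dominates `(1 - t ^ 2) * x ^ 2`; degrees above `d / 2` are reflected. -/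
theorem krawtchouk_sq_le {d k : ℕ} {t : ℝ} (hk : k ≤ d) (hke : Even k) (ht : d * t = d - 2 * k)
    {M m : ℕ} (hMm : M ≤ m) (hmd : m + M ≤ d) :
    krawtchouk d k m ^ 2 * (1 - t ^ 2) ≤ krawtchouk d k M ^ 2 + krawtchouk d k (M + 1) ^ 2
      - 2 * t * krawtchouk d k M * krawtchouk d k (M + 1) := by
  set V : ℕ → ℝ := fun m => krawtchouk d k m ^ 2 + krawtchouk d k (m + 1) ^ 2
      - 2 * t * krawtchouk d k m * krawtchouk d k (m + 1) with hV
  have step : ∀ m, 2 * (m + 1) ≤ d → V (m + 1) ≤ V m := by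
    intro m hm
    have hr := krawtchouk_add_two hk (show m + 1 ≤ d by omega)
    rw [← ht] at hr
    simp only [hV]
    set x := krawtchouk d k m
    set y := krawtchouk d k (m + 1)
    set z := krawtchouk d k (m + 1 + 1)
    have hm' : 2 * ((m : ℝ) + 1) ≤ d := by exact_mod_cast hm
    set p : ℝ := m + 1
    have hp : 0 < p := by positivity
    -- `V (m + 1)` and `V m` have the common part `(1 - t ^ 2) * y ^ 2`; compare the other squares
    have e : (d - p) * (z - t * y) = p * (t * y - x) := by linear_combination hr
    have h1 : ((d - p) * (z - t * y)) ^ 2 ≤ ((d - p) * (x - t * y)) ^ 2 := by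
      rw [e, mul_pow, mul_pow, ← neg_sq (t * y - x), neg_sub]
      exact mul_le_mul_of_nonneg_right (pow_le_pow_left₀ hp.le (by linarith) 2) (sq_nonneg _)
    rw [mul_pow, mul_pow, mul_le_mul_iff_right₀ (pow_pos (by linarith) 2)] at h1
    nlinarith
  have low : ∀ m, M ≤ m → 2 * m ≤ d → krawtchouk d k m ^ 2 * (1 - t ^ 2) ≤ V M := by
    intro m hMm hmd
    have hVm : V m ≤ V M := by
      induction m, hMm using Nat.le_induction with
      | base => exact le_rfl
      | succ n hn ih => exact (step n hmd).trans (ih (by omega))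
    refine le_trans ?_ hVm
    simp only [hV]
    nlinarith [sq_nonneg (krawtchouk d k (m + 1) - t * krawtchouk d k m)]
  by_cases h : 2 * m ≤ d
  · exact low m hMm h
  · rw [← krawtchouk_sub hk hke (by omega : m ≤ d)]
    exact low (d - m) (by omega) (by omega)

theorem tendsto_krawtchouk {D K : ℕ → ℕ} {t : ℝ} {l : Filter ℕ} (hD : Tendsto D l atTop)
    (hK : ∀ᶠ N in l, K N ≤ D N) (ht : ∀ᶠ N in l, D N * t = D N - 2 * K N) (m : ℕ) :
    Tendsto (fun N => krawtchouk (D N) (K N) m) l (𝓝 (t ^ m)) := by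
  have hD' : Tendsto (fun N => (D N : ℝ)) l atTop := tendsto_natCast_atTop_atTop.comp hD
  induction m using Nat.strong_induction_on with
  | _ m ih =>
  match m with
  | 0 => simpa [krawtchouk_zero] using tendsto_const_nhds
  | 1 =>
    rw [pow_one]
    refine tendsto_const_nhds.congr' ?_
    filter_upwards [hD.eventually_ge_atTop 1, hK, ht] with N hN hK ht
    have h0 : (D N : ℝ) ≠ 0 := by exact_mod_cast (show D N ≠ 0 by omega)
    refine mul_left_cancel₀ h0 ?_
    rw [krawtchouk_one hK, ht]
  | m + 2 =>
    have hμ : Tendsto (fun N => ((m : ℝ) + 1) / D N) l (𝓝 0) := hD'.const_div_atTop _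
    have h := (((ih (m + 1) (by omega)).const_mul t).sub (hμ.mul (ih m (by omega)))).div
      (tendsto_const_nhds (x := (1 : ℝ)).sub hμ) (by norm_num)
    have e : (t * t ^ (m + 1) - 0 * t ^ m) / (1 - 0) = t ^ (m + 2) := by ring
    rw [e] at h
    refine h.congr' ?_
    filter_upwards [hD.eventually_ge_atTop (m + 2), hK, ht] with N hN hK ht
    have h0 : (0 : ℝ) < D N := by exact_mod_cast (show 0 < D N by omega)
    have h1 : (0 : ℝ) < D N - (m + 1) := by
      have : ((m + 2 : ℕ) : ℝ) ≤ D N := by exact_mod_cast hN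
      push_cast at this
      linarith
    have hr := krawtchouk_add_two hK (show m + 1 ≤ D N by omega)
    rw [← ht] at hr
    simp only [Pi.div_apply]
    rw [div_eq_iff]
    · field_simp
      linear_combination -hr
    · have : 1 - ((m : ℝ) + 1) / D N = (D N - (m + 1)) / D N := by field_simp
      rw [this]
      positivity

/-! ### Fourier analysis on the cube -/

section Cube

variable {d : ℕ}

/-- The character `ε ↦ ∏ i ∈ S, ε i` of the cube `{1, -1} ^ d`. -/
def cubeChar (S : Finset (Fin d)) (ε : Fin d → ℤˣ) : ℝ := ∏ i ∈ S, (((ε i : ℤˣ) : ℤ) : ℝ)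

theorem units_cast_mul_self (x : ℤˣ) : ((x : ℤ) : ℝ) * ((x : ℤ) : ℝ) = 1 := by
  rcases Int.units_eq_one_or x with rfl | rfl <;> simp

theorem cubeChar_mul (S : Finset (Fin d)) (ε η : Fin d → ℤˣ) :
    cubeChar S (ε * η) = cubeChar S ε * cubeChar S η := by
  simp [cubeChar, Finset.prod_mul_distrib]

/-- The function on the cube that corresponds to `g` when the points of the cube are scaled to
unit vectors. -/
noncomputable def cubeFun (g : ℝ → ℝ) (ε : Fin d → ℤˣ) : ℝ :=
  g ((∑ i, (((ε i : ℤˣ) : ℤ) : ℝ)) / d)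

/-- The Fourier coefficients of `cubeFun g`, without the normalizing factor `2 ^ d`. -/
noncomputable def cubeCoeff (g : ℝ → ℝ) (S : Finset (Fin d)) : ℝ :=
  ∑ ε : Fin d → ℤˣ, cubeFun g ε * cubeChar S ε

/-- Up to the factor `2 ^ d` the coefficient at `S` is the quadratic form of `g` on the vertices of
the inscribed cube, weighted by the character of `S`. -/
theorem OperatesOnGram.cubeCoeff_nonneg {g : ℝ → ℝ} (hg : OperatesOnGram g) (hd : 0 < d)
    (S : Finset (Fin d)) : 0 ≤ cubeCoeff g S := by
  have hd' : (0 : ℝ) < d := by exact_mod_cast hd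
  let u : (Fin d → ℤˣ) → EuclideanSpace ℝ (Fin d) := fun ε =>
    WithLp.toLp 2 fun i => (((ε i : ℤˣ) : ℤ) : ℝ) / √d
  have hin : ∀ ε η, inner ℝ (u ε) (u η) = (∑ i, ((((ε * η) i : ℤˣ) : ℤ) : ℝ)) / d := by
    intro ε η
    rw [PiLp.inner_apply, Finset.sum_div]
    refine Finset.sum_congr rfl fun i _ => ?_
    simp only [u, Pi.mul_apply, Units.val_mul, Int.cast_mul, RCLike.inner_apply, conj_trivial]
    rw [div_mul_div_comm, Real.mul_self_sqrt hd'.le, mul_comm]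
  have hu : ∀ ε, ‖u ε‖ = 1 := by
    intro ε
    rw [← pow_eq_one_iff_of_nonneg (norm_nonneg _) two_ne_zero, ← real_inner_self_eq_norm_sq, hin]
    simp [hd'.ne']
  have h := hg _ _ u (cubeChar S) hu
  have e : ∀ ε, ∑ η, cubeChar S ε * cubeChar S η * g (inner ℝ (u ε) (u η)) = cubeCoeff g S := by
    intro ε
    rw [cubeCoeff, ← Equiv.sum_comp (Equiv.mulLeft ε) (fun η => cubeFun g η * cubeChar S η)]
    refine Finset.sum_congr rfl fun η _ => ?_
    rw [hin, Equiv.coe_mulLeft, cubeChar_mul]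
    unfold cubeFun
    ring
  simp only [e, Finset.sum_const, nsmul_eq_mul] at h
  refine nonneg_of_mul_nonneg_right h ?_
  exact_mod_cast Finset.card_pos.2 ⟨1, Finset.mem_univ _⟩

/-- The coefficients are invariant under permutations of the coordinates. -/
theorem cubeCoeff_eq_of_card_eq (g : ℝ → ℝ) {S T : Finset (Fin d)} (h : S.card = T.card) :
    cubeCoeff g S = cubeCoeff g T := by
  classical
  let e : {x // x ∈ S} ≃ {x // x ∈ T} := Finset.equivOfCardEq h
  let σ : Equiv.Perm (Fin d) := e.extendSubtype
  have hσ : S.map σ.toEmbedding = T := by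
    refine Finset.eq_of_subset_of_card_le (fun x hx => ?_) (by rw [Finset.card_map, h])
    obtain ⟨y, hy, rfl⟩ := Finset.mem_map.1 hx
    exact e.extendSubtype_mem y hy
  unfold cubeCoeff
  rw [← (σ.arrowCongr (Equiv.refl ℤˣ)).sum_comp (fun ε => cubeFun g ε * cubeChar T ε)]
  refine Finset.sum_congr rfl fun ε _ => ?_
  congr 1
  · unfold cubeFun
    rw [← σ.symm.sum_comp (fun i => (((ε i : ℤˣ) : ℤ) : ℝ))]
    rfl
  · unfold cubeChar
    rw [← hσ, Finset.prod_map]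
    refine Finset.prod_congr rfl fun i _ => ?_
    simp [Equiv.arrowCongr]

/-- Fourier inversion on the cube. -/
theorem sum_cubeCoeff_mul_cubeChar (g : ℝ → ℝ) (η : Fin d → ℤˣ) :
    ∑ S, cubeCoeff g S * cubeChar S η = 2 ^ d * cubeFun g η := by
  classical
  unfold cubeCoeff
  simp only [Finset.sum_mul]
  rw [Finset.sum_comm]
  have h : ∀ ε : Fin d → ℤˣ, ∑ S, cubeFun g ε * cubeChar S ε * cubeChar S η =
      cubeFun g ε * ∏ i, (1 + (((ε * η) i : ℤˣ) : ℤ) : ℝ) := by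
    intro ε
    rw [Finset.prod_one_add, Finset.powerset_univ, Finset.mul_sum]
    refine Finset.sum_congr rfl fun S _ => ?_
    rw [mul_assoc, ← cubeChar_mul]
    rfl
  simp only [h]
  rw [Finset.sum_eq_single η]
  · simp only [Pi.mul_apply, Units.val_mul, Int.cast_mul, units_cast_mul_self, Finset.prod_const,
      Finset.card_univ, Fintype.card_fin]
    norm_num
    ring
  · intro ε _ hne
    obtain ⟨i, hi⟩ := Function.ne_iff.1 hne
    have : (1 + (((ε * η) i : ℤˣ) : ℤ) : ℝ) = 0 := by
      rcases Int.units_eq_one_or (ε i) with h1 | h1 <;>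
        rcases Int.units_eq_one_or (η i) with h2 | h2 <;> simp_all
    rw [Finset.prod_eq_zero (Finset.mem_univ i) this, mul_zero]
  · simp

/-- The point of the cube whose first `k` coordinates are `-1`. -/
def cubePoint (d k : ℕ) (i : Fin d) : ℤˣ := if (i : ℕ) < k then -1 else 1

theorem cubePoint_cast (k : ℕ) (i : Fin d) :
    (((cubePoint d k i : ℤˣ) : ℤ) : ℝ) = if (i : ℕ) < k then -1 else 1 := by
  unfold cubePoint
  split_ifs <;> simp

theorem range_filter_lt {k : ℕ} (hk : k ≤ d) :
    (Finset.range d).filter (· < k) = Finset.range k := by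
  ext x
  simp
  omega

theorem range_filter_not_lt (k : ℕ) :
    (Finset.range d).filter (¬ · < k) = Finset.Ico k d := by
  ext x
  simp
  omega

theorem sum_cubePoint {k : ℕ} (hk : k ≤ d) :
    ∑ i, (((cubePoint d k i : ℤˣ) : ℤ) : ℝ) = d - 2 * k := by
  simp only [cubePoint_cast]
  rw [Fin.sum_univ_eq_sum_range (fun i => if i < k then (-1 : ℝ) else 1), Finset.sum_ite,
    range_filter_lt hk, range_filter_not_lt]
  simp [Nat.cast_sub hk]
  ring

open Polynomial in
theorem sum_cubeChar_cubePoint {k : ℕ} (hk : k ≤ d) (m : ℕ) :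
    ∑ S ∈ Finset.powersetCard m Finset.univ, cubeChar S (cubePoint d k) =
      d.choose m * krawtchouk d k m := by
  classical
  rw [← krawtchoukGen_coeff hk]
  have h : krawtchoukGen d k =
      ∏ i : Fin d, (1 + C (((cubePoint d k i : ℤˣ) : ℤ) : ℝ) * X) := by
    have e : ∀ i : Fin d, (1 + C (((cubePoint d k i : ℤˣ) : ℤ) : ℝ) * X : ℝ[X]) =
        if (i : ℕ) < k then 1 - X else 1 + X := by
      intro i
      rw [cubePoint_cast]
      split_ifs
      · simp [sub_eq_add_neg]
      · simp
    simp only [e]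
    rw [Fin.prod_univ_eq_prod_range (fun i => if i < k then (1 - X : ℝ[X]) else 1 + X),
      Finset.prod_ite, range_filter_lt hk, range_filter_not_lt]
    simp [krawtchoukGen, mul_comm]
  rw [h, Finset.prod_one_add, finsetSum_coeff, Finset.powersetCard_eq_filter, Finset.sum_filter]
  refine Finset.sum_congr rfl fun S _ => ?_
  rw [Finset.prod_mul_distrib, Finset.prod_const, ← map_prod, coeff_C_mul_X_pow]
  simp only [eq_comm]
  rfl

end Cube

/-- The values of `g` at the inner products `(d - 2 * k) / d` of the vertices of a cube inscribed in
the sphere, expanded in characters. -/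
theorem OperatesOnGram.exists_krawtchouk_expansion {g : ℝ → ℝ} (hg : OperatesOnGram g) {d : ℕ}
    (hd : 0 < d) : ∃ A : ℕ → ℝ, (∀ m, 0 ≤ A m) ∧ ∀ k ≤ d,
      g (((d : ℝ) - 2 * k) / d) = ∑ m ∈ Finset.range (d + 1), A m * krawtchouk d k m := by
  classical
  refine ⟨fun m => (∑ S ∈ Finset.powersetCard m (Finset.univ : Finset (Fin d)), cubeCoeff g S)
    / 2 ^ d, fun m => div_nonneg (Finset.sum_nonneg fun S _ => hg.cubeCoeff_nonneg hd S)
      (by positivity), fun k hk => ?_⟩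
  have h := sum_cubeCoeff_mul_cubeChar g (cubePoint d k)
  rw [cubeFun, sum_cubePoint hk, ← Finset.powerset_univ, Finset.sum_powerset, Finset.card_univ,
    Fintype.card_fin] at h
  have h2 : (2 : ℝ) ^ d ≠ 0 := by positivity
  rw [← mul_right_inj' h2, ← h, Finset.mul_sum]
  refine Finset.sum_congr rfl fun m _ => ?_
  rw [← mul_assoc, mul_div_cancel₀ _ h2, Finset.sum_mul]
  rcases (Finset.powersetCard m (Finset.univ : Finset (Fin d))).eq_empty_or_nonempty with
    h0 | ⟨T, hT⟩
  · simp [h0]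
  have hc : ∀ S ∈ Finset.powersetCard m (Finset.univ : Finset (Fin d)),
      cubeCoeff g S = cubeCoeff g T := fun S hS => cubeCoeff_eq_of_card_eq g
    ((Finset.mem_powersetCard.1 hS).2.trans (Finset.mem_powersetCard.1 hT).2.symm)
  rw [Finset.sum_congr rfl fun S hS => by rw [hc S hS], ← Finset.mul_sum,
    sum_cubeChar_cubePoint hk,
    Finset.sum_congr (g := fun _ => cubeCoeff g T * krawtchouk d k m) rfl
      fun S hS => by rw [hc S hS]]
  rw [Finset.sum_const, Finset.card_powersetCard, Finset.card_univ, Fintype.card_fin, nsmul_eq_mul]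
  ring

/-! ### The power series on the open interval -/

namespace OperatesOnGram

variable {g : ℝ → ℝ}

/-- For even `k` the characters of degree `m` and `d - m` agree, so their coefficients are
combined; what remains beyond degree `M` is a nonnegative combination of total weight at most
`g 1`. -/
theorem exists_krawtchouk_approx (hg : OperatesOnGram g) {d : ℕ} (hd : 0 < d) :
    ∃ B : ℕ → ℝ, (∀ m, 0 ≤ B m) ∧
      (∀ M, 2 * M ≤ d → ∑ m ∈ Finset.range M, B m ≤ g 1) ∧
      ∀ k ≤ d, Even k → ∀ M, 2 * M ≤ d → ∀ τ : ℝ, 0 ≤ τ →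
        (∀ m, M ≤ m → m + M ≤ d → |krawtchouk d k m| ≤ τ) →
        |g (((d : ℝ) - 2 * k) / d) - ∑ m ∈ Finset.range M, B m * krawtchouk d k m| ≤ g 1 * τ := by
  obtain ⟨A, hA, hexp⟩ := hg.exists_krawtchouk_expansion hd
  have hsplit : ∀ (f : ℕ → ℝ) (M : ℕ), 2 * M ≤ d → ∑ m ∈ Finset.range (d + 1), f m =
      ∑ m ∈ Finset.range M, (f m + f (d - m)) + ∑ m ∈ Finset.Ico M (d + 1 - M), f m := by
    intro f M hM
    have h1 : ∑ m ∈ Finset.range M, f (d - m) = ∑ m ∈ Finset.Ico (d + 1 - M) (d + 1), f m := by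
      rw [← Finset.sum_range_reflect, Finset.sum_Ico_eq_sum_range,
        show d + 1 - (d + 1 - M) = M by omega]
      refine Finset.sum_congr rfl fun j hj => ?_
      have := Finset.mem_range.1 hj
      congr 1
      omega
    rw [Finset.sum_add_distrib, h1, add_assoc, add_comm (∑ m ∈ Finset.Ico (d + 1 - M) _, f m),
      Finset.sum_Ico_consecutive _ (by omega) (by omega),
      Finset.sum_range_add_sum_Ico _ (by omega)]
  have hd' : (d : ℝ) ≠ 0 := by exact_mod_cast hd.ne'
  have htot : g 1 = ∑ m ∈ Finset.range (d + 1), A m := by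
    have h := hexp 0 (Nat.zero_le d)
    rw [Nat.cast_zero, mul_zero, sub_zero, div_self hd'] at h
    rw [h]
    refine Finset.sum_congr rfl fun m hm => ?_
    rw [krawtchouk_zero_right (by have := Finset.mem_range.1 hm; omega), mul_one]
  refine ⟨fun m => A m + A (d - m), fun m => add_nonneg (hA _) (hA _), fun M hM => ?_,
    fun k hk hke M hM τ hτ hκ => ?_⟩
  · rw [htot, hsplit A M hM]
    exact le_add_of_nonneg_right (Finset.sum_nonneg fun m _ => hA m)
  · have h1 : ∑ m ∈ Finset.range M, (A m + A (d - m)) * krawtchouk d k m =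
        ∑ m ∈ Finset.range M, (A m * krawtchouk d k m + A (d - m) * krawtchouk d k (d - m)) := by
      refine Finset.sum_congr rfl fun m hm => ?_
      rw [krawtchouk_sub hk hke (by have := Finset.mem_range.1 hm; omega), add_mul]
    rw [hexp k hk, hsplit _ M hM, h1, add_sub_cancel_left]
    calc |∑ m ∈ Finset.Ico M (d + 1 - M), A m * krawtchouk d k m|
        ≤ ∑ m ∈ Finset.Ico M (d + 1 - M), A m * τ := by
          refine (Finset.abs_sum_le_sum_abs _ _).trans (Finset.sum_le_sum fun m hm => ?_)
          rw [abs_mul, abs_of_nonneg (hA m)]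
          have := Finset.mem_Ico.1 hm
          exact mul_le_mul_of_nonneg_left (hκ m this.1 (by omega)) (hA m)
      _ = (∑ m ∈ Finset.Ico M (d + 1 - M), A m) * τ := (Finset.sum_mul _ _ _).symm
      _ ≤ g 1 * τ := by
          refine mul_le_mul_of_nonneg_right ?_ hτ
          rw [htot, hsplit A M hM]
          exact le_add_of_nonneg_left (Finset.sum_nonneg fun m _ => add_nonneg (hA _) (hA _))

/-- On rational points `g` is a power series: let the dimension of the cube tend to infinity along
multiples of large factorials, so that every rational point is eventually an inner product with an
even number of sign changes, and take limits of the coefficients along an ultrafilter. -/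
theorem exists_powerSeries_rat (hg : OperatesOnGram g) :
    ∃ b : ℕ → ℝ, (∀ m, 0 ≤ b m) ∧ Summable b ∧
      ∀ q : ℚ, |(q : ℝ)| < 1 → HasSum (fun m => b m * (q : ℝ) ^ m) (g q) := by
  have hdpos : ∀ N : ℕ, 0 < 4 * N.factorial := fun N => by positivity
  choose B hB0 hBsum hB using fun N => hg.exists_krawtchouk_approx (hdpos N)
  let U : Ultrafilter ℕ := hyperfilter ℕ
  have hU : (U : Filter ℕ) ≤ atTop := Nat.hyperfilter_le_atTop
  have hD : Tendsto (fun N : ℕ => 4 * N.factorial) U atTop := by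
    refine Tendsto.mono_left (tendsto_atTop_mono (fun N => ?_) tendsto_id) hU
    have := N.self_le_factorial
    simp only [id]
    omega
  have hlim : ∀ m, ∃ b, b ∈ Set.Icc 0 (g 1) ∧ Tendsto (fun N => B N m) U (𝓝 b) := by
    intro m
    obtain ⟨b, hb, hb'⟩ := (isCompact_Icc (a := (0 : ℝ)) (b := g 1)).ultrafilter_le_nhds'
      (U.map fun N => B N m) (by
        rw [Ultrafilter.mem_map]
        refine (hD.eventually_ge_atTop (2 * (m + 1))).mono fun N hN => ?_
        exact ⟨hB0 N m, (Finset.single_le_sum (fun i _ => hB0 N i)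
          (Finset.mem_range.2 (Nat.lt_succ_self m))).trans (hBsum N (m + 1) hN)⟩)
    exact ⟨b, hb, hb'⟩
  choose b hb hlimb using hlim
  have hsum : ∀ M, ∑ m ∈ Finset.range M, b m ≤ g 1 := fun M =>
    le_of_tendsto (tendsto_finsetSum _ fun m _ => hlimb m)
      ((hD.eventually_ge_atTop (2 * M)).mono fun N hN => hBsum N M hN)
  have hsummable : Summable b :=
    summable_of_sum_range_le (fun m => (hb m).1) hsum
  refine ⟨b, fun m => (hb m).1, hsummable, fun q hq => ?_⟩
  set t : ℝ := (q : ℝ) with ht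
  have ht2 : 0 < 1 - t ^ 2 := by
    rw [sub_pos, sq_lt_one_iff_abs_lt_one]
    exact hq
  obtain ⟨hq1, hq2⟩ := abs_lt.1 hq
  -- `N ! / q.den` is an integer once `N` is at least `q.den`
  let K : ℕ → ℕ := fun N => 2 * (N.factorial / q.den * (q.den - q.num).toNat)
  have hnum : 0 ≤ (q.den : ℤ) - q.num := by
    have h1 : q < 1 := by
      rw [ht] at hq2
      exact_mod_cast hq2
    have := Rat.num_lt_denom_iff.2 h1
    omega
  have hK : ∀ N, q.den ≤ N →
      ((4 * N.factorial : ℕ) : ℝ) * t = ((4 * N.factorial : ℕ) : ℝ) - 2 * (K N : ℝ) := by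
    intro N hN
    obtain ⟨c, hc⟩ := Nat.dvd_factorial q.den_pos hN
    have hden : (q.den : ℝ) ≠ 0 := by exact_mod_cast q.den_nz
    have h1 : (((q.den - q.num).toNat : ℕ) : ℝ) = q.den - q.num := by
      have := Int.toNat_of_nonneg hnum
      exact_mod_cast this
    have h2 : t * q.den = q.num := by
      rw [ht]
      exact_mod_cast Rat.mul_den_eq_num q
    simp only [K]
    rw [hc, Nat.mul_div_cancel_left _ q.den_pos]
    push_cast
    rw [h1, ← h2]
    ring
  have hKd : ∀ N, q.den ≤ N → K N ≤ 4 * N.factorial := by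
    intro N hN
    have h0 : (0 : ℝ) < ((4 * N.factorial : ℕ) : ℝ) := by exact_mod_cast hdpos N
    have : (K N : ℝ) ≤ ((4 * N.factorial : ℕ) : ℝ) := by nlinarith [hK N hN]
    exact_mod_cast this
  have hev : ∀ᶠ N in (U : Filter ℕ), q.den ≤ N := hU (eventually_ge_atTop _)
  have hκ := tendsto_krawtchouk hD (hev.mono hKd) (hev.mono hK)
  have hbound : ∀ M, |g t - ∑ m ∈ Finset.range M, b m * t ^ m| ≤ g 1 * |t| ^ M := by
    intro M
    have hτ : Tendsto (fun N => √((krawtchouk (4 * N.factorial) (K N) M ^ 2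
        + krawtchouk (4 * N.factorial) (K N) (M + 1) ^ 2
        - 2 * t * krawtchouk (4 * N.factorial) (K N) M
          * krawtchouk (4 * N.factorial) (K N) (M + 1)) / (1 - t ^ 2))) U (𝓝 (|t| ^ M)) := by
      have h := (((((hκ M).pow 2).add ((hκ (M + 1)).pow 2)).sub
        (((hκ M).const_mul (2 * t)).mul (hκ (M + 1)))).div_const (1 - t ^ 2)).sqrt
      have e : √(((t ^ M) ^ 2 + (t ^ (M + 1)) ^ 2 - 2 * t * t ^ M * t ^ (M + 1)) / (1 - t ^ 2))
          = |t| ^ M := by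
        rw [← abs_pow, ← Real.sqrt_sq_eq_abs]
        congr 1
        rw [div_eq_iff ht2.ne']
        ring
      rwa [e] at h
    refine le_of_tendsto_of_tendsto ((tendsto_const_nhds.sub (tendsto_finsetSum _ fun m _ =>
      (hlimb m).mul (hκ m))).abs) (hτ.const_mul (g 1)) ?_
    filter_upwards [hev, hD.eventually_ge_atTop (2 * M)] with N hN hNM
    have h0 : ((4 * N.factorial : ℕ) : ℝ) ≠ 0 := by exact_mod_cast (hdpos N).ne'
    have h := hB N (K N) (hKd N hN) (even_two_mul _) M hNM _ (Real.sqrt_nonneg _)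
      fun m h1 h2 => Real.abs_le_sqrt ((le_div_iff₀ ht2).2
        (krawtchouk_sq_le (hKd N hN) (even_two_mul _) (hK N hN) h1 h2))
    rwa [← hK N hN, mul_div_cancel_left₀ _ h0] at h
  have hs := (summable_mul_pow_of_abs_le_one (fun m => (hb m).1) hsummable hq.le).hasSum
  suffices h : Tendsto (fun M => ∑ m ∈ Finset.range M, b m * t ^ m) atTop (𝓝 (g t)) by
    rwa [tendsto_nhds_unique hs.tendsto_sum_nat h] at hs
  have h0 : Tendsto (fun M : ℕ => g 1 * |t| ^ M) atTop (𝓝 0) := by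
    simpa using (tendsto_pow_atTop_nhds_zero_of_lt_one (abs_nonneg t) hq).const_mul (g 1)
  rw [tendsto_iff_norm_sub_tendsto_zero]
  refine squeeze_zero (fun M => norm_nonneg _) (fun M => ?_) h0
  rw [norm_sub_rev]
  exact hbound M

end OperatesOnGram

theorem continuousOn_tsum_mul_pow {b : ℕ → ℝ} (hb : ∀ m, 0 ≤ b m) (hs : Summable b) :
    ContinuousOn (fun t : ℝ => ∑' m, b m * t ^ m) (Set.Icc (-1) 1) := by
  refine continuousOn_tsum (fun m => by fun_prop) hs fun m t ht => ?_
  rw [Real.norm_eq_abs, abs_mul, abs_pow, abs_of_nonneg (hb m)]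
  exact mul_le_of_le_one_right (hb m) (pow_le_one₀ (abs_nonneg t) (abs_le.2 ht))

namespace OperatesOnGram

variable {g : ℝ → ℝ}

/-- Three collinear vectors `√a`, `t / √a` and `s / √a`: the quadratic form with weights `1`, `l`
and `-l` shows that `g t - g s` is controlled by values of `g` at nonnegative points when `s`
and `t` have the same sign. -/
theorem three_point_nonneg (hg : OperatesOnGram g) {a s t : ℝ} (ha : 0 < a) (ha1 : a ≤ 1)
    (hs : s ^ 2 ≤ a) (ht : t ^ 2 ≤ a) (l : ℝ) :
    0 ≤ g a + 2 * l * (g t - g s) +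
      l ^ 2 * (g (t * t / a) + g (s * s / a) - 2 * g (t * s / a)) := by
  have hr := Real.mul_self_sqrt ha.le
  have hr0 : √a ≠ 0 := (Real.sqrt_pos.2 ha).ne'
  have h := hg.sum_nonneg_of_norm_le_one ![√a, t / √a, s / √a] ![1, l, -l] (by
    have hn : ∀ x : ℝ, x ^ 2 ≤ a → ‖x / √a‖ ≤ 1 := by
      intro x hx
      rw [Real.norm_eq_abs, ← sq_le_one_iff_abs_le_one, div_pow, Real.sq_sqrt ha.le]
      exact (div_le_one₀ ha).2 hx
    intro i
    fin_cases i
    · rw [Real.norm_eq_abs, ← sq_le_one_iff_abs_le_one]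
      simpa [Real.sq_sqrt ha.le] using ha1
    · exact hn t ht
    · exact hn s hs)
  have e1 : ∀ x : ℝ, √a * (x / √a) = x := fun x => by field_simp
  have e2 : ∀ x : ℝ, x / √a * √a = x := fun x => by field_simp
  have e3 : ∀ x y : ℝ, x / √a * (y / √a) = x * y / a := fun x y => by
    rw [div_mul_div_comm, hr]
  have hin : ∀ x y : ℝ, inner ℝ x y = x * y := fun x y => by simp [mul_comm]
  simp only [Fin.sum_univ_three, hin, Matrix.cons_val_zero, Matrix.cons_val_one, Matrix.cons_val,
    hr, e1, e2, e3, mul_comm s t] at h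
  linarith

/-- A function operating on Gram matrices is a power series with nonnegative coefficients in the
open interval. -/
theorem exists_powerSeries (hg : OperatesOnGram g) :
    ∃ b : ℕ → ℝ, (∀ m, 0 ≤ b m) ∧ Summable b ∧
      ∀ t : ℝ, |t| < 1 → g t = ∑' m, b m * t ^ m := by
  obtain ⟨b, hb, hbs, hq⟩ := hg.exists_powerSeries_rat
  refine ⟨b, hb, hbs, ?_⟩
  set h : ℝ → ℝ := fun t => ∑' m, b m * t ^ m with hh
  have hrat : ∀ q : ℚ, |(q : ℝ)| < 1 → g q = h q := fun q hq1 => (hq q hq1).tsum_eq.symm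
  have hcont : ∀ t, |t| < 1 → ContinuousAt h t := fun t ht =>
    (continuousOn_tsum_mul_pow hb hbs).continuousAt (Icc_mem_nhds (abs_lt.1 ht).1 (abs_lt.1 ht).2)
  have hopen : ∀ t : ℝ, |t| < 1 → ∀ᶠ s in 𝓝 t, |s| < 1 := fun t ht =>
    continuous_abs.continuousAt.eventually_lt continuousAt_const ht
  -- for positive arguments the monotone function `g` is squeezed between rational points
  have hpos : ∀ t : ℝ, 0 < t → t < 1 → g t = h t := by
    intro t ht0 ht1
    have hta : |t| < 1 := by rwa [abs_of_pos ht0]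
    refine le_antisymm ?_ ?_
    · obtain ⟨s, -, hs, hlim⟩ := Real.exists_seq_rat_strictAnti_tendsto t
      refine ge_of_tendsto ((hcont t hta).tendsto.comp hlim) ?_
      filter_upwards [hlim.eventually (hopen t hta)] with n hn
      rw [Function.comp_apply, ← hrat _ hn]
      refine hg.apply_le_of_abs_le ?_ (abs_lt.1 hn).2.le
      rw [abs_of_pos ht0]
      exact (hs n).le
    · obtain ⟨s, -, hs, hlim⟩ := Real.exists_seq_rat_strictMono_tendsto t
      refine le_of_tendsto ((hcont t hta).tendsto.comp hlim) ?_
      filter_upwards [hlim.eventually (hopen t hta), hlim.eventually (lt_mem_nhds ht0)] with n hn hn0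
      rw [Function.comp_apply, ← hrat _ hn]
      refine hg.apply_le_of_abs_le ?_ ht1.le
      rw [abs_of_pos hn0]
      exact (hs n).le
  intro t ht
  change g t = h t
  rcases eq_or_ne t 0 with rfl | ht0
  · have := hrat 0 (by simp)
    simpa using this
  have ht2 : t ^ 2 < 1 := by rwa [sq_lt_one_iff_abs_lt_one]
  obtain ⟨a, hat, ha1⟩ := exists_between ht2
  have ht2' : 0 < t ^ 2 := by positivity
  have ha : 0 < a := ht2'.trans hat
  obtain ⟨s, -, -, hs⟩ := Real.exists_seq_rat_strictMono_tendsto t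
  -- passing to the limit along rational `s` eliminates the quadratic term in `l`
  have key : ∀ l : ℝ, 0 ≤ g a + 2 * l * (g t - h t) := by
    intro l
    have hta : 0 < t * t / a ∧ t * t / a < 1 := by
      rw [← pow_two]
      exact ⟨by positivity, (div_lt_one ha).2 hat⟩
    have hta' : |t * t / a| < 1 := by rw [abs_of_pos hta.1]; exact hta.2
    have l1 : Tendsto (fun n => (s n : ℝ) * s n / a) atTop (𝓝 (t * t / a)) :=
      (hs.mul hs).div_const a
    have l2 : Tendsto (fun n => t * s n / a) atTop (𝓝 (t * t / a)) :=
      (hs.const_mul t).div_const a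
    have hlim : Tendsto (fun n => g a + 2 * l * (g t - h (s n)) +
        l ^ 2 * (h (t * t / a) + h (s n * s n / a) - 2 * h (t * s n / a))) atTop
        (𝓝 (g a + 2 * l * (g t - h t) +
          l ^ 2 * (h (t * t / a) + h (t * t / a) - 2 * h (t * t / a)))) :=
      (tendsto_const_nhds.add ((tendsto_const_nhds.sub
        ((hcont t ht).tendsto.comp hs)).const_mul _)).add
        (((tendsto_const_nhds.add ((hcont _ hta').tendsto.comp l1)).sub
          (((hcont _ hta').tendsto.comp l2).const_mul 2)).const_mul _)
    have e : l ^ 2 * (h (t * t / a) + h (t * t / a) - 2 * h (t * t / a)) = 0 := by ring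
    rw [e, add_zero] at hlim
    refine ge_of_tendsto hlim ?_
    filter_upwards [hs.eventually (hopen t ht), l1.eventually (lt_mem_nhds hta.1),
      l1.eventually (gt_mem_nhds hta.2), l2.eventually (lt_mem_nhds hta.1),
      l2.eventually (gt_mem_nhds hta.2)] with n h1 h2 h3 h4 h5
    rw [← hrat _ h1, ← hpos _ hta.1 hta.2, ← hpos _ h2 h3, ← hpos _ h4 h5]
    refine hg.three_point_nonneg ha ha1.le ?_ hat.le l
    rw [pow_two]
    exact ((div_lt_one ha).1 h3).le
  -- a function affine in `l` that is bounded below is constant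
  by_contra hne
  have hne' : g t - h t ≠ 0 := sub_ne_zero.2 hne
  have hk := key (-(g a + 1) / (2 * (g t - h t)))
  have e : 2 * (-(g a + 1) / (2 * (g t - h t))) * (g t - h t) = -(g a + 1) := by
    field_simp
  rw [e] at hk
  linarith

end OperatesOnGram

/-! ### The endpoints and uniqueness -/

theorem iverson_of {P : Prop} (h : P) : iverson P = 1 := if_pos h

theorem iverson_of_not {P : Prop} (h : ¬P) : iverson P = 0 := if_neg h

/-- The value of the series with coefficients `α` at the inner product `t`. -/
noncomputable def SeriesCoeffs.value (α : SeriesCoeffs) (t : ℝ) : ℝ :=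
  ∑' m : ℕ, α.power m * t ^ m + α.odd * (iverson (t = 1) - iverson (t = -1))
    + α.even * iverson (t ∈ ({-1, 1} : Set ℝ))

namespace SeriesCoeffs

theorem value_of_abs_lt_one (α : SeriesCoeffs) {t : ℝ} (ht : |t| < 1) :
    α.value t = ∑' m, α.power m * t ^ m := by
  obtain ⟨h1, h2⟩ := abs_lt.1 ht
  have h3 : t ∉ ({-1, 1} : Set ℝ) := by
    rintro (h | h)
    · exact h1.ne' h
    · exact h2.ne h
  rw [value, iverson_of_not h1.ne', iverson_of_not h2.ne, iverson_of_not h3]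
  ring

theorem value_one (α : SeriesCoeffs) :
    α.value 1 = ∑' m, α.power m * 1 ^ m + α.odd + α.even := by
  rw [value, iverson_of rfl, iverson_of_not (by norm_num), iverson_of (by simp)]
  ring

theorem value_neg_one (α : SeriesCoeffs) :
    α.value (-1) = ∑' m, α.power m * (-1) ^ m - α.odd + α.even := by
  rw [value, iverson_of rfl, iverson_of_not (by norm_num), iverson_of (by simp)]
  ring

end SeriesCoeffs

/-- The coefficients of a power series are determined by its sum in `(-1, 1)`. -/
theorem eq_of_tsum_mul_pow_eq {a b : ℕ → ℝ} (ha : Summable a) (hb : Summable b)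
    (h : ∀ t : ℝ, |t| < 1 → ∑' m, a m * t ^ m = ∑' m, b m * t ^ m) : a = b := by
  have hps : ∀ c : ℕ → ℝ, Summable c → HasFPowerSeriesAt (fun t : ℝ => ∑' m, c m * t ^ m)
      (FormalMultilinearSeries.ofScalars ℝ c) 0 := by
    intro c hc
    have hr : (1 : ENNReal) ≤ (FormalMultilinearSeries.ofScalars ℝ c).radius := by
      refine FormalMultilinearSeries.le_radius_of_summable (r := 1) _ ?_
      simpa [FormalMultilinearSeries.ofScalars_norm] using hc.norm
    have h := (FormalMultilinearSeries.hasFPowerSeriesOnBall _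
      (one_pos.trans_le hr)).hasFPowerSeriesAt
    have e : (FormalMultilinearSeries.ofScalars ℝ c).sum = fun t : ℝ => ∑' m, c m * t ^ m := by
      exact FormalMultilinearSeries.ofScalarsSum_eq_tsum (E := ℝ) c
    rwa [e] at h
  have := (hps a ha).eq_formalMultilinearSeries_of_eventually (hps b hb) (by
    filter_upwards [Metric.ball_mem_nhds (0 : ℝ) one_pos] with t ht
    exact h t (by simpa using ht))
  exact FormalMultilinearSeries.ofScalars_series_injective ℝ ℝ this

theorem SeriesCoeffs.eq_of_value_eq {α β : SeriesCoeffs} (hα : Summable α.power)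
    (hβ : Summable β.power) (h : ∀ t : ℝ, |t| ≤ 1 → α.value t = β.value t) : α = β := by
  have hp : α.power = β.power := eq_of_tsum_mul_pow_eq hα hβ fun t ht => by
    rw [← α.value_of_abs_lt_one ht, ← β.value_of_abs_lt_one ht, h t ht.le]
  have h1 := h 1 (by simp)
  have h2 := h (-1) (by simp)
  rw [value_one, value_one, hp] at h1
  rw [value_neg_one, value_neg_one, hp] at h2
  exact SeriesCoeffs.ext hp (by linarith) (by linarith)

/-- The power series of `g` on `(-1, 1)` is completed by the jumps at `±1`. The coefficients of the
odd and of the even jump are nonnegative by `OperatesOnGram.endpoint_le`, as `ρ → 1`. -/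
theorem OperatesOnGram.exists_seriesCoeffs {g : ℝ → ℝ} (hg : OperatesOnGram g) :
    ∃ α : SeriesCoeffs, (∀ m, 0 ≤ α.power m) ∧ 0 ≤ α.odd ∧ 0 ≤ α.even ∧ Summable α.power ∧
      ∀ t : ℝ, |t| ≤ 1 → g t = α.value t := by
  obtain ⟨b, hb, hbs, hgb⟩ := hg.exists_powerSeries
  have hcont := continuousOn_tsum_mul_pow hb hbs
  set h : ℝ → ℝ := fun t => ∑' m, b m * t ^ m with hh
  -- `endpoint_le` as `ρ` tends to `1` from below, where `g` may be replaced by its series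
  have hend : ∀ s : ℝ, s = 1 ∨ s = -1 → h 1 + s * h (-1) ≤ g 1 + s * g (-1) := by
    intro s hs
    have hmem : Set.Ioo (0 : ℝ) 1 ∈ 𝓝[<] (1 : ℝ) := Ioo_mem_nhdsLT one_pos
    have h1 : Tendsto h (𝓝[<] 1) (𝓝 (h 1)) :=
      (hcont 1 (by norm_num)).mono_left (nhdsWithin_le_of_mem (by
        filter_upwards [hmem] with x hx
        exact ⟨by linarith [hx.1], hx.2.le⟩))
    have h2 : Tendsto (fun ρ => h (-ρ)) (𝓝[<] 1) (𝓝 (h (-1))) := by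
      refine (hcont (-1) (by norm_num)).tendsto.comp (tendsto_nhdsWithin_iff.2 ⟨?_, ?_⟩)
      · exact (continuous_neg.tendsto 1).mono_left nhdsWithin_le_nhds
      · filter_upwards [hmem] with x hx
        exact ⟨by linarith [hx.2], by linarith [hx.1]⟩
    refine le_of_tendsto (h1.add (h2.const_mul s)) ?_
    filter_upwards [hmem] with ρ hρ
    have hρ1 : |ρ| < 1 := by rw [abs_of_pos hρ.1]; exact hρ.2
    have e1 : h ρ = g ρ := (hgb ρ hρ1).symm
    have e2 : h (-ρ) = g (-ρ) := (hgb (-ρ) (by rwa [abs_neg])).symm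
    rw [e1, e2]
    exact hg.endpoint_le hs hρ1.le
  have hplus := hend 1 (Or.inl rfl)
  have hminus := hend (-1) (Or.inr rfl)
  refine ⟨⟨b, (g 1 - g (-1) - (h 1 - h (-1))) / 2, (g 1 + g (-1) - (h 1 + h (-1))) / 2⟩, hb,
    by dsimp only; linarith, by dsimp only; linarith, hbs, fun t ht => ?_⟩
  rcases ht.lt_or_eq with ht | ht
  · rw [SeriesCoeffs.value_of_abs_lt_one _ ht]
    exact hgb t ht
  · rcases eq_or_eq_neg_of_abs_eq ht with rfl | rfl
    · rw [SeriesCoeffs.value_one]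
      change g 1 = h 1 + _ + _
      ring
    · rw [SeriesCoeffs.value_neg_one]
      change g (-1) = h (-1) - _ + _
      ring

theorem exists_inner_eq {t : ℝ} (ht : |t| ≤ 1) :
    ∃ u v : UnitSphere 1, (inner ℝ u.1 v.1 : ℝ) = t := by
  have hr := Real.mul_self_sqrt (show 0 ≤ 1 - t ^ 2 by
    rw [sub_nonneg, sq_le_one_iff_abs_le_one]; exact ht)
  refine ⟨⟨!₂[1, 0], mem_sphere_zero_iff_norm.2 (norm_pair_eq_one (by ring))⟩,
    ⟨!₂[t, √(1 - t ^ 2)], mem_sphere_zero_iff_norm.2 (norm_pair_eq_one (by rw [hr]; ring))⟩, ?_⟩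
  rw [inner_pair]
  ring

theorem theorem1 (k : ∀ n : ℕ, UnitSphere n → UnitSphere n → ℝ) (hk : IsRadialKernel k) :
    (∀ n : ℕ, IsPosDefKernel (k n)) ↔ ∃! α : SeriesCoeffs, IsSeriesRepresentation k α := by
  refine ⟨fun hpd => ?_, fun ⟨α, hα, _⟩ n => hα.isPosDefKernel n⟩
  obtain ⟨f, hf⟩ := hk
  obtain ⟨g, hg⟩ : ∃ g : ℝ → ℝ, ∀ (n : ℕ) (u v : UnitSphere n),
      k n u v = g (inner ℝ u.1 v.1) := by
    refine ⟨fun t => f √(2 - 2 * t), fun n u v => ?_⟩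
    have h : (2 : ℝ) - 2 * inner ℝ u.1 v.1 = dist u v ^ 2 := by
      rw [Subtype.dist_eq, dist_eq_norm, norm_sub_sq_real, norm_eq_of_mem_sphere u,
        norm_eq_of_mem_sphere v]
      ring
    dsimp only
    rw [hf, h, Real.sqrt_sq dist_nonneg]
  obtain ⟨α, hp, ho, he, hs, hval⟩ := (operatesOnGram_of_isPosDefKernel hg hpd).exists_seriesCoeffs
  refine ⟨α, ⟨hp, ho, he, hs, fun n u v => ?_⟩, fun β hβ => ?_⟩
  · rw [hg]
    exact hval _ (abs_inner_sphere_le_one u v)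
  · refine SeriesCoeffs.eq_of_value_eq hβ.summable hs fun t ht => ?_
    obtain ⟨u, v, rfl⟩ := exists_inner_eq ht
    rw [← hval _ ht, ← hg]
    exact (hβ.eq 1 u v).symm
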